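/- Let $Z$ be an infinite-dimensional separable real Hilbert space, $C(Z)$ its Clifford algebra (with relations $vw+wv=-2(v,w)$), $\sigma$ an isometric complex structure on $Z$, and $z_1,z_2,\dots\in Z$ such that $\{z_k,\sigma(z_k)\}_{k\ge1}$ is an orthonormal basis of $Z$. Let $X=(\mathbb Z/2)^{\mathbb N}$ be the group of sequences $x=(x_1,x_2,\dots)$ of zeros and ones, with the $\sigma$-algebra generated by the sets $\{x_k=1\}$; let $\Delta\subset X$ be the subgroup of sequences with finitely many ones, and let $\delta_k\in\Delta$ have its only $1$ in the $k$-th place. Consider triples $(\mu,\nu,\{c_k\})$, where * $\mu$ is a $\sigma$-finite positive measure on $X$, quasi-invariant under $\Delta$: for $\delta\in\Delta$ the measures $\mu$ and $\mu_\delta(E)=\mu(E+\delta)$ have the same null sets; * $\nu:X\to\{0,1,2,\dots,\infty\}$ is measurable, and for all $\delta\in\Delta$, $\nu(x+\delta)=\nu(x)$ for almost all $x$. Put $H_x=H_{\nu(x)}$, where $H_n\subset\ell^2(\mathbb N,\mathbb C)$ is the span of the first $n$ standard basis vectors and $H_\infty=\ell^2(\mathbb N,\mathbb C)$; * $c_k(x)$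 ($k\ge1$) are unitary operators of $H_x$, depending measurably on $x$, such that for all $k,l$ and almost all $x$, $c_k(x)^*=c_k(x+\delta_k)$ and $c_k(x)c_l(x+\delta_k)=c_l(x)c_k(x+\delta_l)$. Let $H=\int_X^\oplus H_x\,d\mu(x)$, i.e. the Hilbert space of all $f\in L^2(X,\mu;\ell^2)$ with $f(x)\in H_x$ almost everywhere. The Gårding–Wightman (GW) module of the triple is the representation of $C(Z)$ on $H$ by bounded complex linear operators which extends the continuous real linear map $v\mapsto\mathbb J_v$, $v\in Z$, determined by $$(\mathbb J_{z_k}f)(x)=(-1)^{x_1+\dots+x_{k-1}+1}\,i\,c_k(x)\sqrt{\frac{d\mu_{\delta_k}}{d\mu}(x)}\;f(x+\delta_k),\qquad(\mathbb J_{\sigma(z_k)}f)(x)=(-1)^{x_k}\,i\,(\mathbb J_{z_k}f)(x).$$ It is irreducible over $\mathbb C$ (over $\mathbb R$) if $H\ne0$ and the only closed complex (real) subspaces of $H$ invariant under $C(Z)$ are $0$ and $H$. An invariant real form is a closed $C(Z)$-invariant real subspace $V\subset H$ on which the scalar product of $H$ is real and for which $H=V\oplus iV$. The measure $\mu$ is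 discrete if it is concentrated on a countable set. **Corollary 3.7.** If $\mu$ is discrete and the GW module of $(\mu,\nu,\{c_k\})$ is irreducible over $\mathbb C$, then it is irreducible over $\mathbb R$. In particular, the Fermi–Fock representation, i.e. the GW module of $(\mu,1,1)$ where $\mu$ is the counting measure on $\Delta$ (so that $\mu(\{\delta\})=1$ for all $\delta\in\Delta$ and $\mu(X\setminus\Delta)=0$), is irreducible over $\mathbb C$ and over $\mathbb R$, and has no invariant real form. -/

import Mathlib

open MeasureTheory
open scoped ENNReal

noncomputable section

namespace GW

/-- The group of sequences `x = (x₀, x₁, …)` of zeros and ones, under componentwise addition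
modulo `2`. The `σ`-algebra is the product one, i.e. the one generated by the sets
`{x | x k = 1}`. -/
abbrev X : Type := ℕ → ZMod 2

/-- The subgroup of the sequences with only finitely many ones. -/
def Delta : AddSubgroup X where
  carrier := {x | {k | x k ≠ 0}.Finite}
  zero_mem' := by simp
  add_mem' {x y} hx hy := by
    refine (Set.Finite.union hx hy).subset fun k hk => ?_
    by_contra h
    simp only [Set.mem_union, Set.mem_ofPred_eq, not_or, not_not] at h
    exact hk (by simp [h.1, h.2])
  neg_mem' {x} hx := by simpa using hx

/-- The sequence whose `k`-th entry is `1` and whose other entries are `0`. -/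
def delta (k : ℕ) : X := Pi.single k 1

lemma delta_mem (k : ℕ) : delta k ∈ Delta := by
  refine (Set.finite_singleton k).subset fun j hj => ?_
  by_contra h
  exact hj (Pi.single_eq_of_ne h _)

lemma add_self (x : X) : x + x = 0 := by
  ext k
  exact CharTwo.add_self_eq_zero (x k)

lemma add_add_self (x y : X) : x + y + y = x := by
  rw [add_assoc, add_self, add_zero]

/-- The translate `E ↦ μ (E + δ)` of a measure `μ` (recall `-δ = δ`). -/
def translate (μ : Measure X) (δ : X) : Measure X := μ.map (fun x => x + δ)

/-- The Hilbert space `ℓ²` in which all fibres are realized. -/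
abbrev L2 : Type := lp (fun _ : ℕ => ℂ) 2

/-- The model Hilbert space of dimension `n ∈ {0, 1, 2, …, ∞}`: the span of the first `n`
vectors of the standard basis of `ℓ²`, and all of `ℓ²` if `n = ∞`. -/
def fiber (n : ℕ∞) : Submodule ℂ L2 where
  carrier := {v | ∀ i : ℕ, n ≤ (i : ℕ∞) → v i = 0}
  zero_mem' := by intro i _; rfl
  add_mem' {v w} hv hw := by
    intro i hi
    have : (v + w) i = v i + w i := rfl
    rw [this, hv i hi, hw i hi, add_zero]
  smul_mem' c v hv := by
    intro i hi
    have : (c • v) i = c • v i := rfl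
    rw [this, hv i hi, smul_zero]

/-- `T` restricts to a unitary operator of the subspace `K` onto itself. -/
def IsUnitaryOn (T : L2 →L[ℂ] L2) (K : Submodule ℂ L2) : Prop :=
  Set.MapsTo T K K ∧ Set.SurjOn T K K ∧ ∀ v ∈ K, ‖T v‖ = ‖v‖

/-- The parameters `(μ, ν, {c_k})` of a Gårding–Wightman module. The Hilbert space `H_x` is
`fiber (ν x)`. -/
structure Triple where
  /-- the measure -/
  μ : Measure X
  sigmaFinite : SigmaFinite μ
  /-- quasi-invariance: the translates of `μ` by finite sequences have the null sets of `μ` -/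
  quasi_invariant : ∀ δ ∈ Delta, translate μ δ ≪ μ ∧ μ ≪ translate μ δ
  /-- the dimensions of the spaces `H_x` -/
  ν : X → ℕ∞
  measurable_ν : Measurable ν
  ν_add : ∀ δ ∈ Delta, ∀ᵐ x ∂μ, ν (x + δ) = ν x
  /-- the operators `c_k(x) : H_x → H_{x + δ_k} = H_x`; only the restriction of `c k x` to
  `fiber (ν x)` is relevant -/
  c : ℕ → X → L2 →L[ℂ] L2
  measurable_c : ∀ k v, AEStronglyMeasurable (fun x => c k x v) μ
  unitary_c : ∀ k, ∀ᵐ x ∂μ, IsUnitaryOn (c k x) (fiber (ν x))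
  /-- `c_k(x)^* = c_k(x + δ_k)` -/
  adjoint_c : ∀ k, ∀ᵐ x ∂μ, ∀ v ∈ fiber (ν x), ∀ w ∈ fiber (ν x),
    inner ℂ (c k x v) w = inner ℂ v (c k (x + delta k) w)
  /-- `c_k(x) c_l(x + δ_k) = c_l(x) c_k(x + δ_l)` -/
  comm_c : ∀ k l, ∀ᵐ x ∂μ, ∀ v ∈ fiber (ν x),
    c k x (c l (x + delta k) v) = c l x (c k (x + delta l) v)

attribute [instance] Triple.sigmaFinite

namespace Triple

variable (D : Triple)

/-- The direct integral `∫^⊕ H_x dμ(x)`: the (classes of) square integrable functions `f` with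
`f(x) ∈ H_x` for almost all `x`. -/
def directIntegral : Submodule ℂ (Lp L2 2 D.μ) where
  carrier := {f | ∀ᵐ x ∂D.μ, f x ∈ fiber (D.ν x)}
  zero_mem' := by
    filter_upwards [Lp.coeFn_zero L2 2 D.μ] with x hx
    rw [hx]
    exact zero_mem _
  add_mem' {f g} hf hg := by
    filter_upwards [hf, hg, Lp.coeFn_add f g] with x h1 h2 h3
    rw [h3]
    exact add_mem h1 h2
  smul_mem' a f hf := by
    filter_upwards [hf, Lp.coeFn_smul a f] with x h1 h3
    rw [h3]
    exact Submodule.smul_mem _ a h1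


lemma isClosed_fiber (n : ℕ∞) : IsClosed (fiber n : Set L2) := by
  have : (fiber n : Set L2) = ⋂ (i : ℕ) (_ : n ≤ (i : ℕ∞)), {v : L2 | v i = 0} := by
    ext v
    simp only [Set.mem_iInter]
    rfl
  rw [this]
  refine isClosed_iInter fun i => isClosed_iInter fun _ => ?_
  refine isClosed_eq ?_ continuous_const
  exact (lp.evalCLM ℂ (fun _ : ℕ => ℂ) 2 i).continuous

lemma isClosed_directIntegral : IsClosed (D.directIntegral : Set (Lp L2 2 D.μ)) := by
  refine IsSeqClosed.isClosed fun u f hu hf => ?_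
  obtain ⟨ns, -, hns⟩ := (tendstoInMeasure_of_tendsto_Lp hf).exists_seq_tendsto_ae
  have h : ∀ᵐ x ∂D.μ, ∀ n, u n x ∈ fiber (D.ν x) := ae_all_iff.2 hu
  change ∀ᵐ x ∂D.μ, f x ∈ fiber (D.ν x)
  filter_upwards [hns, h] with x h1 h2
  exact (isClosed_fiber _).mem_of_tendsto h1 (Filter.Eventually.of_forall fun n => h2 _)

/-- The complex Hilbert space of the module, with the structure inherited from `L²(X, μ; ℓ²)`. -/
def H : Type := D.directIntegral

instance : NormedAddCommGroup D.H := inferInstanceAs (NormedAddCommGroup D.directIntegral)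

instance : InnerProductSpace ℂ D.H := inferInstanceAs (InnerProductSpace ℂ D.directIntegral)

instance : CompleteSpace D.H := D.isClosed_directIntegral.completeSpace_coe

/-- The elements of `H` are (classes of) functions on `X`. -/
instance : CoeOut D.H (Lp L2 2 D.μ) := ⟨Subtype.val⟩

/-- The Radon–Nikodym derivative `dμ(x + δ) / dμ(x)`. -/
def density (δ : X) (x : X) : ℝ := ((translate D.μ δ).rnDeriv D.μ x).toReal


lemma measurable_add_right (δ : X) : Measurable fun x : X => x + δ :=
  measurable_id.add_const δ

/-- Translation by `δ` as a measurable equivalence. -/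
def shift (δ : X) : X ≃ᵐ X where
  toFun x := x + δ
  invFun x := x + δ
  left_inv x := add_add_self x δ
  right_inv x := add_add_self x δ
  measurable_toFun := measurable_add_right δ
  measurable_invFun := measurable_add_right δ

lemma translate_eq (δ : X) : translate D.μ δ = D.μ.map (shift δ) := rfl

instance (δ : X) : SigmaFinite (translate D.μ δ) := (shift δ).sigmaFinite_map

lemma quasiMeasurePreserving {δ : X} (hδ : δ ∈ Delta) :
    Measure.QuasiMeasurePreserving (fun x : X => x + δ) D.μ D.μ :=
  ⟨measurable_add_right δ, (D.quasi_invariant δ hδ).1⟩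

lemma ae_shift {δ : X} (hδ : δ ∈ Delta) {p : X → Prop} (h : ∀ᵐ x ∂D.μ, p x) :
    ∀ᵐ x ∂D.μ, p (x + δ) :=
  (D.quasiMeasurePreserving hδ).ae h

lemma lintegral_density {δ : X} (hδ : δ ∈ Delta) {g : X → ℝ≥0∞} (hg : AEMeasurable g D.μ) :
    ∫⁻ x, (translate D.μ δ).rnDeriv D.μ x * g (x + δ) ∂D.μ = ∫⁻ x, g x ∂D.μ := by
  have h1 : AEMeasurable (fun x => g (x + δ)) D.μ :=
    hg.comp_quasiMeasurePreserving (D.quasiMeasurePreserving hδ)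
  rw [lintegral_rnDeriv_mul (D.quasi_invariant δ hδ).1 h1, translate_eq, lintegral_map_equiv]
  simp only [shift, MeasurableEquiv.coe_mk, Equiv.coe_fn_mk, add_add_self]

lemma density_nonneg (δ x : X) : 0 ≤ D.density δ x := ENNReal.toReal_nonneg

lemma density_mul {δ ε : X} (hδ : δ ∈ Delta) (hε : ε ∈ Delta) :
    ∀ᵐ x ∂D.μ, D.density δ x * D.density ε (x + δ) = D.density (δ + ε) x := by
  have hmap : translate D.μ (δ + ε) = (translate D.μ ε).map (shift δ) := by
    unfold translate
    rw [Measure.map_map (shift δ).measurable (measurable_add_right ε)]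
    congr 1
    ext x : 1
    change x + (δ + ε) = x + ε + δ
    abel
  have h1 := (shift δ).measurableEmbedding.rnDeriv_map (translate D.μ ε) D.μ
  have hac : translate D.μ (δ + ε) ≪ translate D.μ δ := by
    rw [hmap, translate_eq]
    exact (D.quasi_invariant ε hε).1.map (shift δ).measurable
  have h2 := Measure.rnDeriv_mul_rnDeriv (κ := D.μ) hac
  have h3 := D.ae_shift hδ h1
  filter_upwards [h2, h3] with x h2 h3
  rw [← hmap, ← translate_eq] at h3
  have h4 : shift δ (x + δ) = x := add_add_self x δ
  rw [h4] at h3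
  rw [Pi.mul_apply, h3] at h2
  unfold density
  rw [← h2, ENNReal.toReal_mul, mul_comm]

lemma density_zero : ∀ᵐ x ∂D.μ, D.density 0 x = 1 := by
  have : translate D.μ 0 = D.μ := by
    unfold translate
    simp only [add_zero]
    exact Measure.map_id'
  filter_upwards [Measure.rnDeriv_self D.μ] with x hx
  rw [density, this, hx]
  simp

lemma c_c (k : ℕ) : ∀ᵐ x ∂D.μ, ∀ v ∈ fiber (D.ν x), D.c k x (D.c k (x + delta k) v) = v := by
  have key : ∀ᵐ x ∂D.μ, ∀ v ∈ fiber (D.ν x), D.c k (x + delta k) (D.c k x v) = v := by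
    filter_upwards [D.unitary_c k, D.ae_shift (delta_mem k) (D.unitary_c k),
      D.ν_add _ (delta_mem k), D.adjoint_c k] with x h1 h2 h3 h4 v hv
    rw [h3] at h2
    have h5 := h4 v hv (D.c k x v) (h1.1 hv)
    have h6 : ‖D.c k (x + delta k) (D.c k x v)‖ = ‖v‖ := by
      rw [h2.2.2 _ (h1.1 hv), h1.2.2 v hv]
    have h7 : ‖v - D.c k (x + delta k) (D.c k x v)‖ ^ 2 = 0 := by
      rw [@norm_sub_sq ℂ, ← h5, h6, inner_self_eq_norm_sq, h1.2.2 v hv]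
      ring
    exact (sub_eq_zero.1 (norm_eq_zero.1 (pow_eq_zero_iff two_ne_zero |>.1 h7))).symm
  filter_upwards [D.ae_shift (delta_mem k) key, D.ν_add _ (delta_mem k)] with x h1 h2 v hv
  rw [h2, add_add_self] at h1
  exact h1 v hv

lemma aestronglyMeasurable_c (k : ℕ) {f : X → L2} (hf : AEStronglyMeasurable f D.μ) :
    AEStronglyMeasurable (fun x => D.c k x (f x)) D.μ := by
  have hs : ∀ s : SimpleFunc X L2, AEStronglyMeasurable (fun x => D.c k x (s x)) D.μ := by
    intro s
    induction s using SimpleFunc.induction with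
    | const v hs =>
      refine ((D.measurable_c k v).indicator hs).congr (Filter.Eventually.of_forall fun x => ?_)
      classical
      simp only [Set.indicator, SimpleFunc.coe_piecewise, SimpleFunc.coe_const, Set.piecewise,
        Function.const_apply]
      split_ifs <;> simp
    | add _ hf hg =>
      refine (hf.add hg).congr (Filter.Eventually.of_forall fun x => ?_)
      simp only [Pi.add_apply, SimpleFunc.coe_add, map_add]
  have h1 : AEStronglyMeasurable (fun x => D.c k x (hf.mk f x)) D.μ := by
    refine aestronglyMeasurable_of_tendsto_ae Filter.atTop
      (fun n => hs (hf.stronglyMeasurable_mk.approx n)) (Filter.Eventually.of_forall fun x => ?_)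
    exact ((D.c k x).continuous.tendsto _).comp (hf.stronglyMeasurable_mk.tendsto_approx x)
  refine h1.congr ?_
  filter_upwards [hf.ae_eq_mk] with x hx
  rw [hx]

/-- The function `x ↦ s(x) c_k(x) √(dμ(x + δ_k) / dμ(x)) f(x + δ_k)`. -/
def weightFun (k : ℕ) (s : X → ℂ) (f : X → L2) (x : X) : L2 :=
  (s x * (Real.sqrt (D.density (delta k) x) : ℂ)) • D.c k x (f (x + delta k))

lemma weightFun_congr (k : ℕ) (s : X → ℂ) {f g : X → L2} (h : f =ᵐ[D.μ] g) :
    D.weightFun k s f =ᵐ[D.μ] D.weightFun k s g := by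
  filter_upwards [D.ae_shift (delta_mem k) h] with x hx
  rw [weightFun, weightFun, hx]

lemma weightFun_mem (k : ℕ) (s : X → ℂ) {f : X → L2} (h : ∀ᵐ x ∂D.μ, f x ∈ fiber (D.ν x)) :
    ∀ᵐ x ∂D.μ, D.weightFun k s f x ∈ fiber (D.ν x) := by
  filter_upwards [D.ae_shift (delta_mem k) h, D.ν_add _ (delta_mem k), D.unitary_c k]
    with x h1 h2 h3
  rw [h2] at h1
  exact Submodule.smul_mem _ _ (h3.1 h1)

lemma weightFun_aestronglyMeasurable (k : ℕ) {s : X → ℂ} (hs : Measurable s) {f : X → L2}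
    (hf : AEStronglyMeasurable f D.μ) : AEStronglyMeasurable (D.weightFun k s f) D.μ := by
  have h1 : Measurable fun x => s x * (Real.sqrt (D.density (delta k) x) : ℂ) :=
    hs.mul (Complex.measurable_ofReal.comp (Real.continuous_sqrt.measurable.comp
      (Measure.measurable_rnDeriv _ _).ennreal_toReal))
  exact h1.aestronglyMeasurable.smul (D.aestronglyMeasurable_c k
    (hf.comp_quasiMeasurePreserving (D.quasiMeasurePreserving (delta_mem k))))

lemma weightFun_eLpNorm (k : ℕ) {s : X → ℂ} (hs : ∀ x, ‖s x‖ = 1) {f : X → L2}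
    (hf : AEStronglyMeasurable f D.μ) (h : ∀ᵐ x ∂D.μ, f x ∈ fiber (D.ν x)) :
    eLpNorm (D.weightFun k s f) 2 D.μ = eLpNorm f 2 D.μ := by
  rw [eLpNorm_eq_lintegral_rpow_enorm_toReal two_ne_zero ENNReal.ofNat_ne_top,
    eLpNorm_eq_lintegral_rpow_enorm_toReal two_ne_zero ENNReal.ofNat_ne_top]
  congr 1
  have hg : AEMeasurable (fun x => ‖f x‖ₑ ^ (2 : ℝ≥0∞).toReal) D.μ := hf.enorm.pow_const _
  rw [← D.lintegral_density (delta_mem k) hg]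
  refine lintegral_congr_ae ?_
  filter_upwards [D.ae_shift (delta_mem k) h, D.ν_add _ (delta_mem k), D.unitary_c k,
    Measure.rnDeriv_lt_top (translate D.μ (delta k)) D.μ] with x h1 h2 h3 h4
  rw [h2] at h1
  have h5 : ‖D.c k x (f (x + delta k))‖ₑ = ‖f (x + delta k)‖ₑ := by
    rw [← ofReal_norm, ← ofReal_norm, h3.2.2 _ h1]
  rw [weightFun, enorm_smul, h5, ENNReal.mul_rpow_of_nonneg _ _ ENNReal.toReal_nonneg]
  congr 1
  rw [← ofReal_norm, norm_mul, hs, one_mul, Complex.norm_real, Real.norm_of_nonneg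
    (Real.sqrt_nonneg _), ENNReal.toReal_ofNat, ENNReal.ofReal_rpow_of_nonneg
    (Real.sqrt_nonneg _) zero_le_two, Real.rpow_two, Real.sq_sqrt (D.density_nonneg _ _), density,
    ENNReal.ofReal_toReal h4.ne]

lemma weightFun_memLp (k : ℕ) {s : X → ℂ} (hs : Measurable s) (hs1 : ∀ x, ‖s x‖ = 1) (f : D.H) :
    MemLp (D.weightFun k s (f : Lp L2 2 D.μ)) 2 D.μ :=
  ⟨D.weightFun_aestronglyMeasurable k hs (Lp.aestronglyMeasurable _),
    (D.weightFun_eLpNorm k hs1 (Lp.aestronglyMeasurable _) f.2).trans_lt (Lp.eLpNorm_lt_top _)⟩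

/-- The isometry `(W f)(x) = s(x) c_k(x) √(dμ(x + δ_k) / dμ(x)) f(x + δ_k)` of the direct
integral, where `|s| = 1`. -/
def weightOp (k : ℕ) (s : X → ℂ) (hs : Measurable s) (hs1 : ∀ x, ‖s x‖ = 1) :
    D.H →ₗᵢ[ℂ] D.H where
  toFun f := (Subtype.mk ((D.weightFun_memLp k hs hs1 f).toLp _) <| by
    filter_upwards [D.weightFun_mem k s f.2, (D.weightFun_memLp k hs hs1 f).coeFn_toLp]
      with x h1 h2
    rw [h2]
    exact h1 : D.directIntegral)
  map_add' f g := by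
    refine Subtype.ext ?_
    change (D.weightFun_memLp k hs hs1 (f + g)).toLp _ =
      (D.weightFun_memLp k hs hs1 f).toLp _ + (D.weightFun_memLp k hs hs1 g).toLp _
    rw [← MemLp.toLp_add, MemLp.toLp_eq_toLp_iff]
    refine (D.weightFun_congr k s (Lp.coeFn_add (f : Lp L2 2 D.μ) g)).trans ?_
    refine Filter.Eventually.of_forall fun x => ?_
    simp only [weightFun, Pi.add_apply, map_add, smul_add]
  map_smul' a f := by
    refine Subtype.ext ?_
    change (D.weightFun_memLp k hs hs1 (a • f)).toLp _ =
      a • (D.weightFun_memLp k hs hs1 f).toLp _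
    rw [← MemLp.toLp_const_smul, MemLp.toLp_eq_toLp_iff]
    refine (D.weightFun_congr k s (Lp.coeFn_smul a (f : Lp L2 2 D.μ))).trans ?_
    refine Filter.Eventually.of_forall fun x => ?_
    simp only [weightFun, Pi.smul_apply, map_smul]
    rw [smul_comm]
  norm_map' f := by
    change ‖(D.weightFun_memLp k hs hs1 f).toLp _‖ = ‖(f : Lp L2 2 D.μ)‖
    rw [Lp.norm_toLp, Lp.norm_def,
      D.weightFun_eLpNorm k hs1 (Lp.aestronglyMeasurable _) f.2]

lemma weightOp_apply (k : ℕ) (s : X → ℂ) (hs : Measurable s) (hs1 : ∀ x, ‖s x‖ = 1) (f : D.H) :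
    ((D.weightOp k s hs hs1 f : Lp L2 2 D.μ) : X → L2) =ᵐ[D.μ]
      D.weightFun k s (f : Lp L2 2 D.μ) :=
  (D.weightFun_memLp k hs hs1 f).coeFn_toLp

lemma weightOp_weightOp (k l : ℕ) (s t : X → ℂ) (hs : Measurable s) (hs1 : ∀ x, ‖s x‖ = 1)
    (ht : Measurable t) (ht1 : ∀ x, ‖t x‖ = 1) (f : D.H) :
    ∀ᵐ x ∂D.μ, (D.weightOp k s hs hs1 (D.weightOp l t ht ht1 f) : Lp L2 2 D.μ) x =
      (s x * t (x + delta k)) • ((Real.sqrt (D.density (delta k + delta l) x) : ℂ) •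
        D.c k x (D.c l (x + delta k) ((f : Lp L2 2 D.μ) (x + (delta k + delta l))))) := by
  filter_upwards [D.weightOp_apply k s hs hs1 (D.weightOp l t ht ht1 f),
    D.ae_shift (delta_mem k) (D.weightOp_apply l t ht ht1 f),
    D.density_mul (delta_mem k) (delta_mem l)] with x h1 h2 h3
  rw [h1, weightFun, h2, weightFun, ← h3, Real.sqrt_mul (D.density_nonneg _ _), map_smul,
    add_assoc, smul_smul, smul_smul]
  congr 1
  push_cast
  ring

/-! ### The phases and the generators -/

/-- The phase `(-1)^{x₀ + … + x_{k-1} + 1} i` of `J_{z_k}`. -/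
def phaseZ (k : ℕ) (x : X) : ℂ :=
  (-1) ^ ((∑ j ∈ Finset.range k, (x j).val) + 1) * Complex.I

/-- The phase of `J_{σ(z_k)}`, which is `(-1)^{x_k} i` times that of `J_{z_k}`. -/
def phaseSigma (k : ℕ) (x : X) : ℂ := (-1) ^ (x k).val * Complex.I * phaseZ k x

lemma measurable_comp_val {β : Type*} [MeasurableSpace β] (g : ZMod 2 → β) (j : ℕ) :
    Measurable fun x : X => g (x j) :=
  (measurable_of_countable g).comp (measurable_pi_apply j)

lemma measurable_phaseZ (k : ℕ) : Measurable (phaseZ k) := by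
  unfold phaseZ
  refine Measurable.mul_const ?_ _
  refine (measurable_of_countable fun n : ℕ => (-1 : ℂ) ^ (n + 1)).comp ?_
  exact Finset.measurable_sum _ fun j _ => measurable_comp_val ZMod.val j

lemma measurable_phaseSigma (k : ℕ) : Measurable (phaseSigma k) :=
  ((measurable_comp_val (fun a => (-1 : ℂ) ^ a.val) k).mul_const _).mul (measurable_phaseZ k)

lemma norm_phaseZ (k : ℕ) (x : X) : ‖phaseZ k x‖ = 1 := by simp [phaseZ]

lemma norm_phaseSigma (k : ℕ) (x : X) : ‖phaseSigma k x‖ = 1 := by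
  simp [phaseSigma, norm_phaseZ]

/-- The operator `J_{z_k}`:
`(J_{z_k} f)(x) = (-1)^{x₀ + … + x_{k-1} + 1} i c_k(x) √(dμ(x + δ_k) / dμ(x)) f(x + δ_k)`. -/
def JZ (k : ℕ) : D.H →ₗᵢ[ℂ] D.H :=
  D.weightOp k (phaseZ k) (measurable_phaseZ k) (norm_phaseZ k)

/-- The operator `J_{σ(z_k)}`: `(J_{σ(z_k)} f)(x) = (-1)^{x_k} i (J_{z_k} f)(x)`. -/
def JSigma (k : ℕ) : D.H →ₗᵢ[ℂ] D.H :=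
  D.weightOp k (phaseSigma k) (measurable_phaseSigma k) (norm_phaseSigma k)

/-- All generators: `J_{z_k}` has the index `inl k` and `J_{σ(z_k)}` the index `inr k`. -/
def gen : ℕ ⊕ ℕ → D.H →L[ℂ] D.H :=
  Sum.elim (fun k => (D.JZ k).toContinuousLinearMap) (fun k => (D.JSigma k).toContinuousLinearMap)

lemma sign_add_self (x : X) (k : ℕ) :
    (-1 : ℂ) ^ ((x + delta k) k).val = -(-1) ^ (x k).val := by
  have h : (x + delta k) k = x k + 1 := by simp [delta]
  rw [h]
  generalize x k = a
  fin_cases a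
  · change (-1 : ℂ) ^ 1 = -(-1) ^ 0
    norm_num
  · change (-1 : ℂ) ^ 0 = -(-1) ^ 1
    norm_num

lemma sign_add_of_ne (x : X) {j k : ℕ} (h : j ≠ k) :
    (-1 : ℂ) ^ ((x + delta k) j).val = (-1) ^ (x j).val := by
  have h : (x + delta k) j = x j := by simp [delta, h]
  rw [h]

lemma phaseZ_eq (k : ℕ) (x : X) :
    phaseZ k x = -(∏ j ∈ Finset.range k, (-1 : ℂ) ^ (x j).val) * Complex.I := by
  rw [phaseZ, pow_succ, Finset.prod_pow_eq_pow_sum]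
  ring

lemma phaseZ_add_of_le (x : X) {k l : ℕ} (h : k ≤ l) : phaseZ k (x + delta l) = phaseZ k x := by
  rw [phaseZ_eq, phaseZ_eq]
  congr 2
  refine Finset.prod_congr rfl fun j hj => sign_add_of_ne x ?_
  have := Finset.mem_range.1 hj
  omega

lemma phaseZ_add_of_lt (x : X) {k l : ℕ} (h : l < k) : phaseZ k (x + delta l) = -phaseZ k x := by
  rw [phaseZ_eq, phaseZ_eq]
  have hl : l ∈ Finset.range k := Finset.mem_range.2 h
  rw [← Finset.mul_prod_erase _ _ hl, ← Finset.mul_prod_erase _ _ hl, sign_add_self,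
    Finset.prod_congr rfl fun j hj => sign_add_of_ne x (Finset.ne_of_mem_erase hj)]
  ring

lemma phaseZ_sq (k : ℕ) (x : X) : phaseZ k x * phaseZ k x = -1 := by
  rw [phaseZ, mul_mul_mul_comm, Complex.I_mul_I, ← mul_pow]
  norm_num

lemma sign_sq (x : X) (k : ℕ) : (-1 : ℂ) ^ (x k).val * (-1) ^ (x k).val = 1 := by
  rw [← mul_pow]
  norm_num

/-- The position of a generator. -/
def pos : ℕ ⊕ ℕ → ℕ := Sum.elim id id

/-- The phase of a generator. -/
def phase : ℕ ⊕ ℕ → X → ℂ := Sum.elim phaseZ phaseSigma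

lemma phase_self (i : ℕ ⊕ ℕ) (x : X) : phase i x * phase i (x + delta (pos i)) = -1 := by
  rcases i with k | k
  · change phaseZ k x * phaseZ k (x + delta k) = -1
    rw [phaseZ_add_of_le x le_rfl, phaseZ_sq]
  · change phaseSigma k x * phaseSigma k (x + delta k) = -1
    rw [phaseSigma, phaseSigma, phaseZ_add_of_le x le_rfl, sign_add_self]
    linear_combination -(Complex.I * Complex.I) * (phaseZ k x * phaseZ k x) * sign_sq x k
      - (phaseZ k x * phaseZ k x) * Complex.I_mul_I + phaseZ_sq k x

lemma phase_add_of_lt (x : X) {i j : ℕ ⊕ ℕ} (h : pos i < pos j) :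
    phase i (x + delta (pos j)) = phase i x ∧ phase j (x + delta (pos i)) = -phase j x := by
  constructor
  · rcases i with k | k
    · exact phaseZ_add_of_le x h.le
    · change phaseSigma k _ = phaseSigma k x
      have h' : k ≠ pos j := ne_of_lt h
      have h2 := phaseZ_add_of_le x (k := k) (le_of_lt h)
      rw [phaseSigma, phaseSigma, h2, sign_add_of_ne x h']
  · rcases j with k | k
    · exact phaseZ_add_of_lt x h
    · change phaseSigma k _ = -phaseSigma k x
      have h' : k ≠ pos i := ne_of_gt h
      have h2 := phaseZ_add_of_lt x (k := k) h
      rw [phaseSigma, phaseSigma, h2, sign_add_of_ne x h']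
      ring

lemma phase_anticomm (x : X) {i j : ℕ ⊕ ℕ} (h : i ≠ j) :
    phase i x * phase j (x + delta (pos i)) = -(phase j x * phase i (x + delta (pos j))) := by
  rcases lt_trichotomy (pos i) (pos j) with hlt | heq | hlt
  · rw [(phase_add_of_lt x hlt).1, (phase_add_of_lt x hlt).2]
    ring
  · rcases i with k | k <;> rcases j with l | l
    · exact absurd (congrArg Sum.inl heq) h
    · obtain rfl : k = l := heq
      change phaseZ k x * phaseSigma k (x + delta k) = -(phaseSigma k x * phaseZ k (x + delta k))
      rw [phaseSigma, phaseSigma, phaseZ_add_of_le x le_rfl, sign_add_self]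
      ring
    · obtain rfl : k = l := heq
      change phaseSigma k x * phaseZ k (x + delta k) = -(phaseZ k x * phaseSigma k (x + delta k))
      rw [phaseSigma, phaseSigma, phaseZ_add_of_le x le_rfl, sign_add_self]
      ring
    · exact absurd (congrArg Sum.inr heq) h
  · rw [(phase_add_of_lt x hlt).1, (phase_add_of_lt x hlt).2]
    ring

lemma gen_gen (i j : ℕ ⊕ ℕ) (f : D.H) :
    ∀ᵐ x ∂D.μ, (D.gen i (D.gen j f) : Lp L2 2 D.μ) x =
      (phase i x * phase j (x + delta (pos i))) •
        ((Real.sqrt (D.density (delta (pos i) + delta (pos j)) x) : ℂ) •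
        D.c (pos i) x (D.c (pos j) (x + delta (pos i))
          ((f : Lp L2 2 D.μ) (x + (delta (pos i) + delta (pos j)))))) := by
  have h : ∀ i, ∃ (h1 : Measurable (phase i)) (h2 : ∀ x, ‖phase i x‖ = 1),
      D.gen i = (D.weightOp (pos i) (phase i) h1 h2).toContinuousLinearMap := by
    rintro (k | k)
    · exact ⟨measurable_phaseZ k, norm_phaseZ k, rfl⟩
    · exact ⟨measurable_phaseSigma k, norm_phaseSigma k, rfl⟩
  obtain ⟨i1, i2, hi⟩ := h i
  obtain ⟨j1, j2, hj⟩ := h j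
  rw [hi, hj]
  exact D.weightOp_weightOp _ _ _ _ i1 i2 j1 j2 f

lemma norm_gen (i : ℕ ⊕ ℕ) (f : D.H) : ‖D.gen i f‖ = ‖f‖ := by
  rcases i with k | k
  · exact (D.JZ k).norm_map f
  · exact (D.JSigma k).norm_map f

lemma gen_self (i : ℕ ⊕ ℕ) (f : D.H) : D.gen i (D.gen i f) = -f := by
  refine Subtype.ext (Lp.ext ?_)
  have h0 : ((-f : D.H) : Lp L2 2 D.μ) = -(f : Lp L2 2 D.μ) := rfl
  rw [h0]
  have hf : ∀ᵐ x ∂D.μ, (f : Lp L2 2 D.μ) x ∈ fiber (D.ν x) := f.2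
  filter_upwards [D.gen_gen i i f, Lp.coeFn_neg (f : Lp L2 2 D.μ), D.density_zero,
    D.c_c (pos i), hf] with x h1 h2 h3 h4 h5
  rw [h1, h2, add_self, add_zero, h3, h4 _ h5, phase_self]
  simp

lemma gen_anticomm {i j : ℕ ⊕ ℕ} (h : i ≠ j) (f : D.H) :
    D.gen i (D.gen j f) = -D.gen j (D.gen i f) := by
  refine Subtype.ext (Lp.ext ?_)
  have h0 : ((-D.gen j (D.gen i f) : D.H) : Lp L2 2 D.μ) =
    -(D.gen j (D.gen i f) : Lp L2 2 D.μ) := rfl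
  rw [h0]
  have hf : ∀ᵐ x ∂D.μ, (f : Lp L2 2 D.μ) x ∈ fiber (D.ν x) := f.2
  have hδ : delta (pos i) + delta (pos j) ∈ Delta := add_mem (delta_mem _) (delta_mem _)
  filter_upwards [D.gen_gen i j f, D.gen_gen j i f,
    Lp.coeFn_neg (D.gen j (D.gen i f) : Lp L2 2 D.μ), D.ae_shift hδ hf, D.ν_add _ hδ,
    D.comm_c (pos i) (pos j)] with x h1 h2 h3 h4 h5 h6
  rw [h5] at h4
  rw [h1, h3, Pi.neg_apply, h2, add_comm (delta (pos j)), h6 _ h4, phase_anticomm x h, neg_smul]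

lemma gen_skew (i : ℕ ⊕ ℕ) (f g : D.H) : inner ℂ (D.gen i f) g = -inner ℂ f (D.gen i g) := by
  have h : ∀ u v : D.H, inner ℂ (D.gen i u) (D.gen i v) = inner ℂ u v := by
    rcases i with k | k
    · exact (D.JZ k).inner_map_map
    · exact (D.JSigma k).inner_map_map
  rw [← h f (D.gen i g), gen_self, inner_neg_right, neg_neg]

/-! ### The action of the Clifford algebra -/

lemma gen_mul_self (i : ℕ ⊕ ℕ) : D.gen i * D.gen i = -1 :=
  ContinuousLinearMap.ext fun f => D.gen_self i f

lemma gen_mul_anticomm {i j : ℕ ⊕ ℕ} (h : i ≠ j) :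
    D.gen i * D.gen j + D.gen j * D.gen i = 0 := by
  refine ContinuousLinearMap.ext fun f => ?_
  change D.gen i (D.gen j f) + D.gen j (D.gen i f) = 0
  rw [D.gen_anticomm h, neg_add_cancel]

end Triple

section Quadratic

variable {Z : Type*} [NormedAddCommGroup Z] [InnerProductSpace ℝ Z]

/-- The quadratic form `v ↦ -(v, v)`, which makes the relations of the Clifford algebra
`v w + w v + 2 (v, w) = 0`. -/
def negNormSq (Z : Type*) [NormedAddCommGroup Z] [InnerProductSpace ℝ Z] : QuadraticForm ℝ Z :=
  -LinearMap.BilinMap.toQuadraticMap (innerₗ Z)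

lemma negNormSq_apply (v : Z) : negNormSq Z v = -inner ℝ v v := rfl

/-- The Clifford algebra `C(Z)`. -/
abbrev Cl (Z : Type*) [NormedAddCommGroup Z] [InnerProductSpace ℝ Z] : Type _ :=
  CliffordAlgebra (negNormSq Z)

end Quadratic

/-! ### Real linear combinations of anticommuting complex structures -/

section Generators

variable {H : Type*} [NormedAddCommGroup H] [InnerProductSpace ℂ H]

/-- A family of skew-hermitian, mutually anticommuting operators with square `-1`. -/
structure IsCliffordSystem {ι : Type*} (e : ι → H →L[ℂ] H) : Prop where
  mul_self : ∀ i, e i * e i = -1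
  anticomm : ∀ i j, i ≠ j → e i * e j + e j * e i = 0
  skew : ∀ i u v, inner ℂ (e i u) v = -inner ℂ u (e i v)

variable {ι : Type*} {e : ι → H →L[ℂ] H}

lemma IsCliffordSystem.sum_mul_self (he : IsCliffordSystem e) (a : ι → ℝ) (s : Finset ι) :
    (∑ i ∈ s, a i • e i) * (∑ i ∈ s, a i • e i) = (-∑ i ∈ s, a i * a i) • (1 : H →L[ℂ] H) := by
  classical
  induction s using Finset.induction_on with
  | empty => simp
  | insert j s hj ih =>
    rw [Finset.sum_insert hj, Finset.sum_insert hj, add_mul, mul_add, mul_add, ih]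
    have h1 : (a j • e j) * (a j • e j) = (-(a j * a j)) • (1 : H →L[ℂ] H) := by
      rw [smul_mul_smul_comm, he.mul_self, smul_neg, neg_smul]
    have h2 : (a j • e j) * (∑ i ∈ s, a i • e i) + (∑ i ∈ s, a i • e i) * (a j • e j) = 0 := by
      rw [Finset.mul_sum, Finset.sum_mul, ← Finset.sum_add_distrib]
      refine Finset.sum_eq_zero fun i hi => ?_
      have hji : j ≠ i := fun h => hj (h ▸ hi)
      rw [smul_mul_smul_comm, smul_mul_smul_comm, mul_comm (a i), ← smul_add,
        he.anticomm j i hji, smul_zero]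
    have h3 : ∀ p q r t : H →L[ℂ] H, q + r = 0 → p + q + (r + t) = p + t := by
      intro p q r t h
      rw [add_assoc, ← add_assoc q, h, zero_add]
    rw [h1, h3 _ _ _ _ h2, neg_add, add_smul]

lemma IsCliffordSystem.norm_sum_apply (he : IsCliffordSystem e) (a : ι → ℝ) (s : Finset ι)
    (f : H) : ‖(∑ i ∈ s, a i • e i) f‖ ^ 2 = (∑ i ∈ s, a i * a i) * ‖f‖ ^ 2 := by
  set T : H →L[ℂ] H := ∑ i ∈ s, a i • e i with hT
  have hskew : ∀ u v : H, inner ℂ (T u) v = -inner ℂ u (T v) := by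
    intro u v
    have happ : ∀ w : H, T w = ∑ i ∈ s, (a i : ℂ) • e i w := by
      intro w
      rw [hT, sum_apply]
      rfl
    rw [happ, happ, sum_inner, inner_sum, ← Finset.sum_neg_distrib]
    refine Finset.sum_congr rfl fun i _ => ?_
    rw [inner_smul_left, inner_smul_right, he.skew, Complex.conj_ofReal, mul_neg]
  have h1 : T (T f) = ((-∑ i ∈ s, a i * a i : ℝ) : ℂ) • f :=
    congrArg (fun S : H →L[ℂ] H => S f) (he.sum_mul_self a s)
  have h2 : inner ℂ (T f) (T f) = ((∑ i ∈ s, a i * a i : ℝ) : ℂ) * inner ℂ f f := by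
    rw [hskew, h1, inner_smul_right, Complex.ofReal_neg]
    ring
  rw [inner_self_eq_norm_sq_to_K, inner_self_eq_norm_sq_to_K] at h2
  apply Complex.ofReal_injective
  push_cast at h2 ⊢
  exact h2

lemma IsCliffordSystem.norm_sum_le (he : IsCliffordSystem e) (a : ι → ℝ) (s : Finset ι) :
    ‖∑ i ∈ s, a i • e i‖ ≤ Real.sqrt (∑ i ∈ s, a i * a i) := by
  refine ContinuousLinearMap.opNorm_le_bound _ (Real.sqrt_nonneg _) fun f => ?_
  rw [← Real.sqrt_sq (norm_nonneg ((∑ i ∈ s, a i • e i) f)), he.norm_sum_apply,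
    Real.sqrt_mul (Finset.sum_nonneg fun i _ => mul_self_nonneg _), Real.sqrt_sq (norm_nonneg f)]

lemma IsCliffordSystem.summable [CompleteSpace H] (he : IsCliffordSystem e) {a : ι → ℝ}
    (ha : Summable fun i => a i * a i) : Summable fun i => a i • e i := by
  rw [summable_iff_vanishing_norm]
  intro ε hε
  obtain ⟨s, hs⟩ := summable_iff_vanishing_norm.1 ha (ε ^ 2) (by positivity)
  refine ⟨s, fun t ht => (he.norm_sum_le a t).trans_lt ?_⟩
  rw [Real.sqrt_lt' hε]
  exact (le_abs_self _).trans_lt (hs t ht)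

lemma HilbertBasis_hasSum_sq {Z : Type*} [NormedAddCommGroup Z] [InnerProductSpace ℝ Z]
    (b : HilbertBasis ι ℝ Z) (v : Z) :
    HasSum (fun i => inner ℝ (b i) v * inner ℝ (b i) v) (inner ℝ v v) := by
  have h := b.hasSum_inner_mul_inner v v
  have h' : (fun i => inner ℝ v (b i) * inner ℝ (b i) v) =
      fun i => inner ℝ (b i) v * inner ℝ (b i) v := by
    funext i
    rw [real_inner_comm v]
  rwa [h'] at h

variable [CompleteSpace H] {Z : Type*} [NormedAddCommGroup Z] [InnerProductSpace ℝ Z]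

/-- The continuous real linear map `v ↦ J_v = ∑ᵢ (bᵢ, v) eᵢ` (the series converges in norm)
which takes the orthonormal basis `(bᵢ)` of `Z` to `(eᵢ)`. -/
def cliffordMap (he : IsCliffordSystem e) (b : HilbertBasis ι ℝ Z) : Z →ₗ[ℝ] (H →L[ℂ] H) where
  toFun v := ∑' i, (inner ℝ (b i) v : ℝ) • e i
  map_add' v w := by
    rw [← (he.summable (HilbertBasis_hasSum_sq b v).summable).tsum_add
      (he.summable (HilbertBasis_hasSum_sq b w).summable)]
    refine tsum_congr fun i => ?_
    rw [inner_add_right, add_smul]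
  map_smul' a v := by
    rw [RingHom.id_apply, ← (he.summable (HilbertBasis_hasSum_sq b v).summable).tsum_const_smul]
    refine tsum_congr fun i => ?_
    rw [real_inner_smul_right, mul_smul]

lemma cliffordMap_basis (he : IsCliffordSystem e) (b : HilbertBasis ι ℝ Z) (i : ι) :
    cliffordMap he b (b i) = e i := by
  change ∑' j, (inner ℝ (b j) (b i) : ℝ) • e j = e i
  rw [tsum_eq_single i]
  · rw [real_inner_self_eq_norm_sq, b.orthonormal.1 i, one_pow, one_smul]
  · intro j hj
    rw [b.orthonormal.2 hj, zero_smul]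

lemma cliffordMap_mul_self (he : IsCliffordSystem e) (b : HilbertBasis ι ℝ Z) (v : Z) :
    cliffordMap he b v * cliffordMap he b v =
      algebraMap ℝ (H →L[ℂ] H) (negNormSq Z v) := by
  have h1 : Filter.Tendsto (fun s : Finset ι => ∑ i ∈ s, (inner ℝ (b i) v : ℝ) • e i)
      Filter.atTop (nhds (cliffordMap he b v)) :=
    (he.summable (HilbertBasis_hasSum_sq b v).summable).hasSum
  have h3 : Filter.Tendsto (fun s : Finset ι => ∑ i ∈ s, inner ℝ (b i) v * inner ℝ (b i) v)
      Filter.atTop (nhds (inner ℝ v v)) := HilbertBasis_hasSum_sq b v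
  rw [Algebra.algebraMap_eq_smul_one, negNormSq_apply]
  refine tendsto_nhds_unique (h1.mul h1) ((h3.neg.smul_const (1 : H →L[ℂ] H)).congr fun s => ?_)
  rw [he.sum_mul_self]

end Generators

/-- A complex structure `σ` on the real Hilbert space `Z`, compatible with the metric, and a
unitary basis `z₀, z₁, …` of `(Z, σ)`, i.e. such that the `z_k` and `σ(z_k)` together form an
orthonormal (Hilbert) basis of the real space `Z`. Its existence means that `Z` is separable and
infinite dimensional. -/
structure UnitaryBasis (Z : Type*) [NormedAddCommGroup Z] [InnerProductSpace ℝ Z] where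
  /-- the complex structure -/
  σ : Z ≃ₗᵢ[ℝ] Z
  σ_σ : ∀ v, σ (σ v) = -v
  /-- the unitary basis -/
  z : ℕ → Z
  orthonormal : Orthonormal ℝ (Sum.elim z (fun k => σ (z k)))
  dense : ⊤ ≤ (Submodule.span ℝ (Set.range (Sum.elim z (fun k => σ (z k))))).topologicalClosure

section Clifford

variable {Z : Type*} [NormedAddCommGroup Z] [InnerProductSpace ℝ Z]
variable [CompleteSpace Z] (B : UnitaryBasis Z)

/-- The real orthonormal basis `{z_k, σ(z_k)}` of `Z`. -/
def UnitaryBasis.basis : HilbertBasis (ℕ ⊕ ℕ) ℝ Z := HilbertBasis.mk B.orthonormal B.dense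

lemma UnitaryBasis.basis_inl (k : ℕ) : B.basis (Sum.inl k) = B.z k := by
  simp [basis]

lemma UnitaryBasis.basis_inr (k : ℕ) : B.basis (Sum.inr k) = B.σ (B.z k) := by
  simp [basis]

namespace Triple

variable (D : Triple)

lemma isCliffordSystem_gen : IsCliffordSystem D.gen :=
  ⟨D.gen_mul_self, fun _ _ h => D.gen_mul_anticomm h, D.gen_skew⟩

/-- The operators `J_v`, `v ∈ Z`: the continuous real linear map which takes the prescribed values
`J_{z_k}` and `J_{σ(z_k)}` on the orthonormal basis `{z_k, σ(z_k)}`. -/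
def J : Z →ₗ[ℝ] (D.H →L[ℂ] D.H) := cliffordMap D.isCliffordSystem_gen B.basis

lemma J_z (k : ℕ) : D.J B (B.z k) = (D.JZ k).toContinuousLinearMap := by
  rw [← B.basis_inl, J, cliffordMap_basis]
  rfl

lemma J_σ_z (k : ℕ) : D.J B (B.σ (B.z k)) = (D.JSigma k).toContinuousLinearMap := by
  rw [← B.basis_inr, J, cliffordMap_basis]
  rfl

/-- The representation of the Clifford algebra `C(Z)` on the Hilbert space of the
Gårding–Wightman module. -/
def rep : Cl Z →ₐ[ℝ] (D.H →L[ℂ] D.H) :=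
  CliffordAlgebra.lift (negNormSq Z) ⟨D.J B, cliffordMap_mul_self D.isCliffordSystem_gen B.basis⟩

lemma rep_ι (v : Z) : D.rep B (CliffordAlgebra.ι (negNormSq Z) v) = D.J B v :=
  CliffordAlgebra.lift_ι_apply _ _ _

end Triple

end Clifford

/-! ### Irreducibility and invariant real forms -/

section Irreducible

variable {Z : Type*} [NormedAddCommGroup Z] [InnerProductSpace ℝ Z]
  {H : Type*} [NormedAddCommGroup H] [InnerProductSpace ℂ H]

/-- `U` is invariant under the action of `C(Z)`. For a complex subspace `U` this is the same as
invariance under `ℂ ⊗ C(Z)`. -/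
def IsInvariant (ρ : Cl Z →ₐ[ℝ] (H →L[ℂ] H)) (U : Set H) : Prop :=
  ∀ a : Cl Z, ∀ f ∈ U, ρ a f ∈ U

/-- Irreducibility over `ℂ`: `H ≠ 0`, and there is no closed invariant complex subspace other
than `0` and `H`. -/
def IsIrreducibleOverC (ρ : Cl Z →ₐ[ℝ] (H →L[ℂ] H)) : Prop :=
  Nontrivial H ∧ ∀ U : Submodule ℂ H, IsClosed (U : Set H) → IsInvariant ρ (U : Set H) →
    U = ⊥ ∨ U = ⊤

/-- Irreducibility over `ℝ`: `H ≠ 0`, and there is no closed invariant real subspace other than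
`0` and `H`. -/
def IsIrreducibleOverR (ρ : Cl Z →ₐ[ℝ] (H →L[ℂ] H)) : Prop :=
  Nontrivial H ∧ ∀ U : Submodule ℝ H, IsClosed (U : Set H) → IsInvariant ρ (U : Set H) →
    U = ⊥ ∨ U = ⊤

/-- `V` is an invariant real form of `H`: a closed invariant real subspace on which the scalar
product is real and such that `H = V ⊕ iV`. Equivalently, `V` is the set of fixed points of a norm
preserving antilinear involution `S` (namely `S (u + i v) = u - i v`) that commutes with `C(Z)`. -/
structure IsInvariantRealForm (ρ : Cl Z →ₐ[ℝ] (H →L[ℂ] H)) (V : Submodule ℝ H) : Prop where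
  isClosed : IsClosed (V : Set H)
  invariant : IsInvariant ρ (V : Set H)
  inner_real : ∀ u ∈ V, ∀ v ∈ V, (inner ℂ u v).im = 0
  decomposition : ∀ f : H, ∃! p : H × H, p.1 ∈ V ∧ p.2 ∈ V ∧ f = p.1 + Complex.I • p.2

end Irreducible

/-- A discrete measure: one that is concentrated on a countable set. -/
def IsDiscrete (μ : Measure X) : Prop := ∃ C : Set X, C.Countable ∧ μ Cᶜ = 0

/-! ### The Fermi–Fock representation -/

instance : Countable Delta := by
  refine Function.Injective.countable (f := fun x : Delta => Set.Finite.toFinset x.2) ?_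
  intro x y h
  have h' : ∀ k, (x : X) k ≠ 0 ↔ (y : X) k ≠ 0 := by
    intro k
    exact (Set.Finite.mem_toFinset x.2).symm.trans
      ((Finset.ext_iff.1 h k).trans (Set.Finite.mem_toFinset y.2))
  have key : ∀ a b : ZMod 2, (a ≠ 0 ↔ b ≠ 0) → a = b := by decide
  exact Subtype.ext (funext fun k => key _ _ (h' k))

/-- The counting measure of `Δ`, as a measure on `X`: the points of `Δ` have mass `1`, and the
complement of `Δ` has mass `0`. -/
def fockMeasure : Measure X := (Measure.count : Measure Delta).map Subtype.val

lemma measurableEmbedding_Delta : MeasurableEmbedding (Subtype.val : Delta → X) :=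
  MeasurableEmbedding.subtype_coe (Set.countable_coe_iff.1 (inferInstanceAs (Countable Delta))).measurableSet

instance : SigmaFinite fockMeasure := measurableEmbedding_Delta.sigmaFinite_map

lemma fockMeasure_eq_zero_iff (E : Set X) : fockMeasure E = 0 ↔ ∀ δ ∈ Delta, δ ∉ E := by
  rw [fockMeasure, measurableEmbedding_Delta.map_apply, Measure.count_eq_zero_iff]
  simp [Set.eq_empty_iff_forall_notMem]

lemma translate_fockMeasure_eq_zero_iff {δ : X} (hδ : δ ∈ Delta) (E : Set X) :
    translate fockMeasure δ E = 0 ↔ fockMeasure E = 0 := by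
  change fockMeasure.map (Triple.shift δ) E = 0 ↔ _
  rw [(Triple.shift δ).map_apply, fockMeasure_eq_zero_iff, fockMeasure_eq_zero_iff]
  constructor
  · intro h ε hε hE
    refine h (ε + δ) (add_mem hε hδ) ?_
    change ε + δ + δ ∈ E
    rwa [add_add_self]
  · intro h ε hε hE
    exact h (ε + δ) (add_mem hε hδ) hE

/-- The triple `(μ, 1, 1)` of the Fermi–Fock representation. -/
def fermiFock : Triple where
  μ := fockMeasure
  sigmaFinite := inferInstance
  quasi_invariant _ hδ :=
    ⟨fun E hE => (translate_fockMeasure_eq_zero_iff hδ E).2 hE,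
      fun E hE => (translate_fockMeasure_eq_zero_iff hδ E).1 hE⟩
  ν _ := 1
  measurable_ν := measurable_const
  ν_add _ _ := Filter.Eventually.of_forall fun _ => rfl
  c _ _ := ContinuousLinearMap.id ℂ L2
  measurable_c _ _ := aestronglyMeasurable_const
  unitary_c _ := Filter.Eventually.of_forall fun _ =>
    ⟨fun _ hv => hv, fun _ hv => ⟨_, hv, rfl⟩, fun _ _ => rfl⟩
  adjoint_c _ := Filter.Eventually.of_forall fun _ _ _ _ _ => rfl
  comm_c _ _ := Filter.Eventually.of_forall fun _ _ _ => rfl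

end GW

end

noncomputable section

namespace GW

open Filter Topology

/-! The product `J_{σ(z_k)} J_{z_k}` shifts twice by `δ_k`, so everything cancels except the phases,
and it is multiplication by `-(-1)^{x_k} i` (`gen_inr_gen_inl`). Everything rests on these
multiplication operators.

On a single orbit `a + Δ` one has `x_k = a_k` for all large `k`, so the operators `-(-1)^{a_k}
J_{σ(z_k)} J_{z_k}`, which are real multiples of Clifford elements, converge strongly to
multiplication by `i` (`I_smul_mem_of_coset`). If `H` lives on one orbit, every closed invariant
real subspace is therefore complex. If `μ` is discrete and the module is irreducible over `ℂ`, this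
is the case: functions vanishing on a given orbit form a closed invariant complex subspace, and
these subspaces cannot all be `H`, because countably many orbits carry `μ`
(`exists_coset_of_isDiscrete`). Irreducibility over `ℝ` follows.

For the Fock module, complex combinations of the same operators give the projections onto cylinders
and, in the limit, onto single points (`cut_singleton_mem`). The fibres are one-dimensional and the
`J_{z_k}` move any point of `Δ` to any other, so a nonzero closed invariant complex subspace has
zero orthogonal complement. A real form would be a closed invariant real subspace other than `0` and
`H`. -/

/-! ### Orbits of `Δ` and signs. -/

/-- An element of `Δ` is the sum of the `δ_k` over its finite support, because `1` is the only
nonzero element of `ZMod 2`. -/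
lemma Delta_induction {p : X → Prop} (x : X) (h0 : p x) (hadd : ∀ y k, p y → p (y + delta k)) :
    ∀ d ∈ Delta, p (x + d) := by
  classical
  have h : ∀ s : Finset ℕ, p (x + ∑ k ∈ s, delta k) := by
    intro s
    induction s using Finset.induction_on with
    | empty => simpa using h0
    | insert k s hk ih =>
      rw [Finset.sum_insert hk, add_comm (delta k), ← add_assoc]
      exact hadd _ _ ih
  intro d hd
  have hd' : {k | d k ≠ 0}.Finite := hd
  have key : ∀ a : ZMod 2, a ≠ 0 → a = 1 := by decide
  have : d = ∑ k ∈ hd'.toFinset, delta k := by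
    ext j
    rw [Finset.sum_apply]
    simp only [delta, Pi.single_apply, Finset.sum_ite_eq, Set.Finite.mem_toFinset,
      Set.mem_ofPred_eq]
    split_ifs with hj
    · exact key _ hj
    · exact not_not.1 hj
  rw [this]
  exact h _

/-- With this, half of `1` plus the product of signs is the indicator of `q = p`, which yields the
projections in `cut_cylinder_mem`. -/
lemma sign_mul_sign (p q : ZMod 2) :
    (-1 : ℂ) ^ p.val * (-1) ^ q.val = if q = p then 1 else -1 := by
  have h : ∀ p : ZMod 2, p = 0 ∨ p = 1 := by decide
  rcases h p with rfl | rfl <;> rcases h q with rfl | rfl <;> simp [ZMod.val_one]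

/-- The orbit of `a` under the finite sequences. -/
def coset (a : X) : Set X := {x | x + a ∈ Delta}

lemma mem_coset_self (a : X) : a ∈ coset a := by
  change a + a ∈ Delta
  rw [add_self]
  exact zero_mem _

lemma countable_Delta : (Delta : Set X).Countable :=
  Set.countable_coe_iff.1 (inferInstanceAs (Countable Delta))

lemma measurableSet_coset (a : X) : MeasurableSet (coset a) :=
  (countable_Delta.measurableSet).preimage (Triple.measurable_add_right a)

lemma add_delta_mem_coset {a x : X} (h : x ∈ coset a) (k : ℕ) : x + delta k ∈ coset a := by
  change x + delta k + a ∈ Delta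
  rw [add_right_comm]
  exact add_mem h (delta_mem k)

/-- The index beyond which the entries agree depends on `x`, so the signs stabilize only pointwise
on the orbit; this is why dominated convergence is needed later. -/
lemma eventually_eq_of_mem_coset {a x : X} (h : x ∈ coset a) : ∀ᶠ k in atTop, x k = a k := by
  have hf : {k | (x + a) k ≠ 0}.Finite := h
  have h' : ∀ᶠ k in cofinite, (x + a) k = 0 := by
    filter_upwards [hf.compl_mem_cofinite] with k hk
    simpa using hk
  rw [Nat.cofinite_eq_atTop] at h'
  filter_upwards [h'] with k hk
  exact CharTwo.add_eq_zero.1 hk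

/-! ### Invariance under `C(Z)` and under the generators. -/

section Invariance

variable {Z : Type*} [NormedAddCommGroup Z] [InnerProductSpace ℝ Z] [CompleteSpace Z]
  (B : UnitaryBasis Z) (D : Triple)

lemma Triple.rep_z (k : ℕ) (f : D.H) :
    D.rep B (CliffordAlgebra.ι (negNormSq Z) (B.z k)) f = D.gen (Sum.inl k) f := by
  rw [D.rep_ι, D.J_z]
  rfl

lemma Triple.rep_σ_z (k : ℕ) (f : D.H) :
    D.rep B (CliffordAlgebra.ι (negNormSq Z) (B.σ (B.z k))) f = D.gen (Sum.inr k) f := by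
  rw [D.rep_ι, D.J_σ_z]
  rfl

lemma Triple.gen_mem_of_isInvariant {U : Set D.H} (hU : IsInvariant (D.rep B) U) (i : ℕ ⊕ ℕ)
    {f : D.H} (hf : f ∈ U) : D.gen i f ∈ U := by
  rcases i with k | k
  · rw [← D.rep_z B]
    exact hU _ _ hf
  · rw [← D.rep_σ_z B]
    exact hU _ _ hf

/-- For general `v` the operator `J_v` is a norm convergent real series in the generators, so
closedness of `U` brings the limit back into `U`; sums, products and real scalars are immediate. -/
lemma Triple.isInvariant_of_gen_mem {U : Submodule ℝ D.H} (hc : IsClosed (U : Set D.H))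
    (hU : ∀ i, ∀ f ∈ U, D.gen i f ∈ U) : IsInvariant (D.rep B) (U : Set D.H) := by
  intro a
  induction a using CliffordAlgebra.induction with
  | algebraMap r =>
    intro f hf
    rw [AlgHom.commutes, Algebra.algebraMap_eq_smul_one]
    exact U.smul_mem r hf
  | ι v =>
    intro f hf
    rw [D.rep_ι]
    have h1 : HasSum (fun i => (inner ℝ (B.basis i) v : ℝ) • D.gen i) (D.J B v) :=
      (D.isCliffordSystem_gen.summable (HilbertBasis_hasSum_sq B.basis v).summable).hasSum
    have h2 : HasSum (fun i => (inner ℝ (B.basis i) v : ℝ) • D.gen i f) (D.J B v f) :=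
      h1.mapL (ContinuousLinearMap.apply ℂ D.H f)
    exact hc.mem_of_tendsto h2 (Eventually.of_forall fun s =>
      U.sum_mem fun i _ => U.smul_mem _ (hU i f hf))
  | mul a b ha hb =>
    intro f hf
    rw [map_mul]
    exact ha _ (hb _ hf)
  | add a b ha hb =>
    intro f hf
    rw [map_add]
    exact U.add_mem (ha _ hf) (hb _ hf)

end Invariance

/-! ### Pointwise calculus in the direct integral. -/

namespace Triple

variable (D : Triple)

lemma gen_apply (i : ℕ ⊕ ℕ) (f : D.H) :
    ((D.gen i f : Lp L2 2 D.μ) : X → L2) =ᵐ[D.μ]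
      D.weightFun (pos i) (phase i) (f : Lp L2 2 D.μ) := by
  rcases i with k | k
  · exact D.weightOp_apply k _ (measurable_phaseZ k) (norm_phaseZ k) f
  · exact D.weightOp_apply k _ (measurable_phaseSigma k) (norm_phaseSigma k) f

lemma gen_apply_eq_zero (i : ℕ ⊕ ℕ) (f : D.H) : ∀ᵐ x ∂D.μ,
    (f : Lp L2 2 D.μ) (x + delta (pos i)) = 0 → (D.gen i f : Lp L2 2 D.μ) x = 0 := by
  filter_upwards [D.gen_apply i f] with x hx h
  rw [hx, weightFun, h, map_zero, smul_zero]

/-- Multiplication by `-i (-1)^{x_k}` belongs to the Clifford algebra. -/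
lemma gen_inr_gen_inl (k : ℕ) (f : D.H) :
    ∀ᵐ x ∂D.μ, (D.gen (Sum.inr k) (D.gen (Sum.inl k) f) : Lp L2 2 D.μ) x =
      (-((-1) ^ (x k).val * Complex.I)) • (f : Lp L2 2 D.μ) x := by
  have hf : ∀ᵐ x ∂D.μ, (f : Lp L2 2 D.μ) x ∈ fiber (D.ν x) := f.2
  filter_upwards [D.gen_gen (Sum.inr k) (Sum.inl k) f, D.density_zero, D.c_c k, hf]
    with x h1 h2 h3 h4
  change _ = (phaseSigma k x * phaseZ k (x + delta k)) •
    ((Real.sqrt (D.density (delta k + delta k) x) : ℂ) •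
      D.c k x (D.c k (x + delta k) ((f : Lp L2 2 D.μ) (x + (delta k + delta k))))) at h1
  -- Both factors shift by the same `δ_k`: the shift, the density and `c_k(x) c_k(x + δ_k) = 1` drop
  -- out, and only the phases remain.
  rw [h1, add_self, add_zero, h2, h3 _ h4, Real.sqrt_one, Complex.ofReal_one, one_smul,
    phaseSigma, phaseZ_add_of_le x le_rfl, mul_assoc, phaseZ_sq, mul_neg_one]

lemma ext_ae {f g : D.H} (h : (f : Lp L2 2 D.μ) =ᵐ[D.μ] (g : Lp L2 2 D.μ)) : f = g :=
  Subtype.ext (Lp.ext h)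

lemma coeFn_add (f g : D.H) : ((f + g : D.H) : Lp L2 2 D.μ) =ᵐ[D.μ]
    fun x => (f : Lp L2 2 D.μ) x + (g : Lp L2 2 D.μ) x :=
  Lp.coeFn_add (f : Lp L2 2 D.μ) g

lemma coeFn_smul (a : ℂ) (f : D.H) : ((a • f : D.H) : Lp L2 2 D.μ) =ᵐ[D.μ]
    fun x => a • (f : Lp L2 2 D.μ) x :=
  Lp.coeFn_smul a (f : Lp L2 2 D.μ)

lemma coeFn_zero : ((0 : D.H) : Lp L2 2 D.μ) =ᵐ[D.μ] fun _ => 0 :=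
  Lp.coeFn_zero L2 2 D.μ

/-- Dominated convergence in the direct integral. -/
lemma tendsto_of_dominated {F : ℕ → D.H} {f g : D.H}
    (hb : ∀ n, ∀ᵐ x ∂D.μ, ‖(F n : Lp L2 2 D.μ) x‖ ≤ ‖(f : Lp L2 2 D.μ) x‖)
    (hl : ∀ᵐ x ∂D.μ, Tendsto (fun n => (F n : Lp L2 2 D.μ) x) atTop
      (𝓝 ((g : Lp L2 2 D.μ) x))) :
    Tendsto F atTop (𝓝 g) := by
  have hind : IsInducing (fun f : D.H => (f : Lp L2 2 D.μ)) := IsInducing.subtypeVal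
  rw [hind.tendsto_nhds_iff]
  refine (Lp.tendsto_Lp_iff_tendsto_eLpNorm' _ _).2 ?_
  simp_rw [eLpNorm_eq_lintegral_rpow_enorm_toReal two_ne_zero ENNReal.ofNat_ne_top]
  have h0 : Tendsto (fun n => ∫⁻ x, ‖((F n : Lp L2 2 D.μ) - (g : Lp L2 2 D.μ) : X → L2) x‖ₑ ^
      (2 : ℝ≥0∞).toReal ∂D.μ) atTop (𝓝 (∫⁻ _, 0 ∂D.μ)) := by
    -- The limit `g` inherits the bound by `‖f‖`, so `‖F n - g‖ ≤ 2 ‖f‖` almost everywhere.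
    refine tendsto_lintegral_of_dominated_convergence'
      (fun x => ‖(2 : ℝ) • (f : Lp L2 2 D.μ) x‖ₑ ^ (2 : ℝ≥0∞).toReal) (fun n => ?_) (fun n => ?_)
      ?_ ?_
    · exact ((Lp.aestronglyMeasurable _).sub (Lp.aestronglyMeasurable _)).enorm.pow_const _
    · filter_upwards [ae_all_iff.2 hb, hl] with x h1 h2
      refine ENNReal.rpow_le_rpow ?_ ENNReal.toReal_nonneg
      rw [enorm_le_iff_norm_le, norm_smul, Real.norm_ofNat, Pi.sub_apply]
      have h3 := le_of_tendsto' h2.norm h1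
      linarith [norm_sub_le ((F n : Lp L2 2 D.μ) x) ((g : Lp L2 2 D.μ) x), h1 n]
    · exact (lintegral_rpow_enorm_lt_top_of_eLpNorm_lt_top two_ne_zero ENNReal.ofNat_ne_top
        ((Lp.memLp (f : Lp L2 2 D.μ)).const_smul (2 : ℝ)).2).ne
    · filter_upwards [hl] with x hx
      have h2 := (ENNReal.continuous_rpow_const (y := (2 : ℝ≥0∞).toReal)).tendsto _ |>.comp
        (hx.sub_const ((g : Lp L2 2 D.μ) x)).enorm
      simpa [Function.comp_def] using h2
  have h1 := (ENNReal.continuous_rpow_const (y := 1 / (2 : ℝ≥0∞).toReal)).tendsto _ |>.comp h0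
  simpa [Function.comp_def] using h1

/-- The function that agrees with `f` on `E` and vanishes off `E`. -/
def cut {E : Set X} (hE : MeasurableSet E) (f : D.H) : D.H :=
  (Subtype.mk (((Lp.memLp (f : Lp L2 2 D.μ)).indicator hE).toLp _) <| by
    have hf : ∀ᵐ x ∂D.μ, (f : Lp L2 2 D.μ) x ∈ fiber (D.ν x) := f.2
    filter_upwards [hf, ((Lp.memLp (f : Lp L2 2 D.μ)).indicator hE).coeFn_toLp] with x h1 h2
    rw [h2]
    by_cases hx : x ∈ E
    · rwa [Set.indicator_of_mem hx]
    · rw [Set.indicator_of_notMem hx]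
      exact zero_mem _ : D.directIntegral)

lemma cut_apply {E : Set X} (hE : MeasurableSet E) (f : D.H) :
    ((D.cut hE f : Lp L2 2 D.μ) : X → L2) =ᵐ[D.μ] E.indicator (f : Lp L2 2 D.μ) :=
  ((Lp.memLp (f : Lp L2 2 D.μ)).indicator hE).coeFn_toLp

/-- The functions that vanish on `E`. -/
def vanishing (E : Set X) : Submodule ℂ D.H where
  carrier := {f | ∀ᵐ x ∂D.μ, x ∈ E → (f : Lp L2 2 D.μ) x = 0}
  zero_mem' := by
    filter_upwards [D.coeFn_zero] with x h _
    exact h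
  add_mem' {f g} hf hg := by
    filter_upwards [hf, hg, D.coeFn_add f g] with x h1 h2 h3 hx
    rw [h3, h1 hx, h2 hx, add_zero]
  smul_mem' a f hf := by
    filter_upwards [hf, D.coeFn_smul a f] with x h1 h2 hx
    rw [h2, h1 hx, smul_zero]

lemma mem_vanishing {E : Set X} {f : D.H} :
    f ∈ D.vanishing E ↔ ∀ᵐ x ∂D.μ, x ∈ E → (f : Lp L2 2 D.μ) x = 0 := Iff.rfl

/-- A sequence converging in `L²` has a subsequence converging almost everywhere, and the limit
vanishes where all terms do. -/
lemma isClosed_vanishing (E : Set X) : IsClosed (D.vanishing E : Set D.H) := by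
  refine IsSeqClosed.isClosed fun u f hu hf => ?_
  have hf' : Tendsto (fun n => (u n : Lp L2 2 D.μ)) atTop (𝓝 (f : Lp L2 2 D.μ)) :=
    (continuous_subtype_val (p := fun f => f ∈ D.directIntegral)).continuousAt.tendsto.comp hf
  obtain ⟨ns, -, hns⟩ := (tendstoInMeasure_of_tendsto_Lp hf').exists_seq_tendsto_ae
  change ∀ᵐ x ∂D.μ, x ∈ E → (f : Lp L2 2 D.μ) x = 0
  filter_upwards [hns, ae_all_iff.2 hu] with x h1 h2 hx
  refine tendsto_nhds_unique h1 ?_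
  simp only [h2 _ hx]
  exact tendsto_const_nhds

/-- A generator reads `f` at `x + δ_k`, which lies in the orbit of `x`. -/
lemma gen_mem_vanishing_coset (a : X) (i : ℕ ⊕ ℕ) {f : D.H} (hf : f ∈ D.vanishing (coset a)) :
    D.gen i f ∈ D.vanishing (coset a) := by
  filter_upwards [D.gen_apply_eq_zero i f, D.ae_shift (delta_mem (pos i)) hf] with x h1 h2 hx
  exact h1 (h2 (add_delta_mem_coset hx _))

/-! ### Discrete measures: from `ℂ` to `ℝ`. -/

section Discrete

variable {Z : Type*} [NormedAddCommGroup Z] [InnerProductSpace ℝ Z] [CompleteSpace Z]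
  (B : UnitaryBasis Z)

/-- Over a discrete measure an irreducible module lives on a single orbit. -/
lemma exists_coset_of_isDiscrete (hd : IsDiscrete D.μ) (h : IsIrreducibleOverC (D.rep B)) :
    ∃ a, ∀ f : D.H, f ∈ D.vanishing (coset a)ᶜ := by
  obtain ⟨C, hC, hC0⟩ := hd
  have hsub : ∀ a, D.vanishing (coset a) = ⊥ ∨ D.vanishing (coset a) = ⊤ := fun a =>
    h.2 _ (D.isClosed_vanishing _) (D.isInvariant_of_gen_mem B
      (U := (D.vanishing (coset a)).restrictScalars ℝ) (D.isClosed_vanishing _)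
      fun i _ hf => D.gen_mem_vanishing_coset a i hf)
  -- Otherwise every `f` vanishes on each orbit; the countably many orbits of points of `C` carry
  -- `μ`, so `f = 0`, against `H ≠ 0`.
  have hex : ∃ a, D.vanishing (coset a) = ⊥ := by
    by_contra! hne
    have htop : ∀ a, D.vanishing (coset a) = ⊤ := fun a => (hsub a).resolve_left (hne a)
    obtain ⟨f, hf⟩ := @exists_ne _ h.1 (0 : D.H)
    refine hf (D.ext_ae ?_)
    have h1 : ∀ᵐ x ∂D.μ, ∀ a ∈ C, x ∈ coset a → (f : Lp L2 2 D.μ) x = 0 :=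
      (ae_ball_iff hC).2 fun a _ => D.mem_vanishing.1 (htop a ▸ Submodule.mem_top)
    have h2 : ∀ᵐ x ∂D.μ, x ∈ C := by
      rw [ae_iff]
      exact hC0
    filter_upwards [h1, h2, D.coeFn_zero] with x h1 h2 h3
    rw [h1 x h2 (mem_coset_self x), h3]
  obtain ⟨a, ha⟩ := hex
  refine ⟨a, fun f => ?_⟩
  have hE := (measurableSet_coset a).compl
  -- The part of `f` off the orbit vanishes on the orbit, hence lies in the zero subspace.
  have h0 : D.cut hE f = 0 := by
    rw [← Submodule.mem_bot ℂ, ← ha, mem_vanishing]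
    filter_upwards [D.cut_apply hE f] with x hx hxa
    rw [hx, Set.indicator_of_notMem (Set.notMem_compl_iff.2 hxa)]
  have h1 := D.cut_apply hE f
  rw [h0] at h1
  rw [mem_vanishing]
  filter_upwards [h1, D.coeFn_zero] with x h1 h2 hx
  rw [← Set.indicator_of_mem hx (f : Lp L2 2 D.μ), ← h1, h2]

/-- Multiplication by `i` is a strong limit of real multiples of Clifford elements, and `U` is
closed. -/
lemma I_smul_mem_of_coset {a : X} (ha : ∀ f : D.H, f ∈ D.vanishing (coset a)ᶜ)
    {U : Submodule ℝ D.H} (hc : IsClosed (U : Set D.H)) (hU : IsInvariant (D.rep B) (U : Set D.H))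
    {f : D.H} (hf : f ∈ U) : Complex.I • f ∈ U := by
  have hsign : ∀ n : ℕ, (-1 : ℂ) * (-1) ^ n * -((-1) ^ n * Complex.I) = Complex.I := by
    intro n
    have : ((-1 : ℂ) ^ n) * (-1) ^ n = 1 := by
      rw [← mul_pow]
      norm_num
    linear_combination Complex.I * this
  -- The factor `-(-1)^{a_k}` is real, so `F k` stays in the real subspace `U`; it turns
  -- `-(-1)^{x_k} i` into `i` as soon as `x_k = a_k`.
  let F : ℕ → D.H := fun k =>
    ((-1 : ℝ) * (-1) ^ (a k).val) • D.gen (Sum.inr k) (D.gen (Sum.inl k) f)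
  have hmem : ∀ k, F k ∈ U := fun k => U.smul_mem _
    (D.gen_mem_of_isInvariant B hU _ (D.gen_mem_of_isInvariant B hU _ hf))
  have hF : ∀ k, ∀ᵐ x ∂D.μ, (F k : Lp L2 2 D.μ) x =
      ((-1 : ℂ) * (-1) ^ (a k).val * -((-1) ^ (x k).val * Complex.I)) •
        (f : Lp L2 2 D.μ) x := by
    intro k
    have hFk : F k = ((-1 : ℂ) * (-1) ^ (a k).val) •
        D.gen (Sum.inr k) (D.gen (Sum.inl k) f) := by
      have hcast : (-1 : ℂ) * (-1) ^ (a k).val = (((-1 : ℝ) * (-1) ^ (a k).val : ℝ) : ℂ) := by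
        push_cast
        rfl
      rw [hcast]
      rfl
    rw [hFk]
    filter_upwards [D.coeFn_smul ((-1 : ℂ) * (-1) ^ (a k).val)
      (D.gen (Sum.inr k) (D.gen (Sum.inl k) f)), D.gen_inr_gen_inl k f] with x h1 h2
    rw [h1, h2, smul_smul]
  refine hc.mem_of_tendsto (D.tendsto_of_dominated (F := F) (f := f) (fun k => ?_) ?_)
    (Eventually.of_forall hmem)
  · filter_upwards [hF k] with x hx
    rw [hx, norm_smul]
    simp
  · filter_upwards [ae_all_iff.2 hF, D.coeFn_smul Complex.I f, ha f] with x h1 h2 h3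
    rw [h2]
    by_cases hx : x ∈ coset a
    · refine tendsto_const_nhds.congr' ?_
      filter_upwards [eventually_eq_of_mem_coset hx] with k hk
      rw [h1, hk, hsign]
    · simp only [h1, h3 hx, smul_zero]
      exact tendsto_const_nhds

theorem isIrreducibleOverR_of_isDiscrete (hd : IsDiscrete D.μ)
    (h : IsIrreducibleOverC (D.rep B)) : IsIrreducibleOverR (D.rep B) := by
  refine ⟨h.1, fun U hc hU => ?_⟩
  obtain ⟨a, ha⟩ := D.exists_coset_of_isDiscrete B hd h
  -- Stability under `i` makes `U` a complex subspace, to which irreducibility over `ℂ` applies.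
  let W : Submodule ℂ D.H :=
    { carrier := U
      zero_mem' := U.zero_mem
      add_mem' := U.add_mem
      smul_mem' := fun z f hf => by
        have hz : z • f = z.re • f + z.im • (Complex.I • f) := by
          change _ = (z.re : ℂ) • f + (z.im : ℂ) • (Complex.I • f)
          rw [smul_smul, ← add_smul, Complex.re_add_im]
        rw [hz]
        exact U.add_mem (U.smul_mem _ hf)
          (U.smul_mem _ (D.I_smul_mem_of_coset B ha hc hU hf)) }
  refine (h.2 W hc hU).imp (fun hW => ?_) (fun hW => ?_)
  · refine (Submodule.eq_bot_iff _).2 fun f hf => ?_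
    have : f ∈ W := hf
    rwa [hW, Submodule.mem_bot] at this
  · refine Submodule.eq_top_iff'.2 fun f => ?_
    have : f ∈ W := hW ▸ Submodule.mem_top
    exact this

end Discrete

/-! ### Projections onto cylinders and points. -/

section Cylinders

variable {Z : Type*} [NormedAddCommGroup Z] [InnerProductSpace ℝ Z] [CompleteSpace Z]
  (B : UnitaryBasis Z)

/-- The sequences which agree with `a` in the first `n` places. -/
def cylinder (a : X) (n : ℕ) : Set X := {x | ∀ k < n, x k = a k}

lemma measurableSet_cylinder (a : X) (n : ℕ) : MeasurableSet (cylinder a n) := by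
  have : cylinder a n = ⋂ (k : ℕ) (_ : k < n), (fun x : X => x k) ⁻¹' {a k} := by
    ext x
    simp [cylinder]
  rw [this]
  exact MeasurableSet.iInter fun k => MeasurableSet.iInter fun _ =>
    (measurable_pi_apply k) (measurableSet_singleton _)

/-- Each further coordinate is fixed by one more projection of the form `(1 + (-1)^{a_n + x_n}) /
2`. Its coefficients involve `i`, hence the complex subspace. -/
lemma cut_cylinder_mem {U : Submodule ℂ D.H} (hU : IsInvariant (D.rep B) (U : Set D.H)) (a : X)
    {f : D.H} (hf : f ∈ U) (n : ℕ) : D.cut (measurableSet_cylinder a n) f ∈ U := by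
  induction n with
  | zero =>
    have h : D.cut (measurableSet_cylinder a 0) f = f := by
      refine D.ext_ae ?_
      filter_upwards [D.cut_apply (measurableSet_cylinder a 0) f] with x hx
      have h0 : x ∈ cylinder a 0 := fun k hk => absurd hk (Nat.not_lt_zero k)
      rw [hx, Set.indicator_of_mem h0]
    rwa [h]
  | succ n ih =>
    set g := D.cut (measurableSet_cylinder a n) f with hg
    -- The coefficient `(1/2) i (-1)^{a_n}` times the multiplier `-(-1)^{x_n} i` is `(1/2) (-1)^{a_n
    -- + x_n}`.
    have hmem : (1 / 2 : ℂ) • g + ((1 / 2 : ℂ) * Complex.I * (-1) ^ (a n).val) •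
        D.gen (Sum.inr n) (D.gen (Sum.inl n) g) ∈ U :=
      U.add_mem (U.smul_mem _ ih) (U.smul_mem _
        (D.gen_mem_of_isInvariant B hU _ (D.gen_mem_of_isInvariant B hU _ ih)))
    convert hmem using 1
    refine D.ext_ae ?_
    filter_upwards [D.cut_apply (measurableSet_cylinder a (n + 1)) f,
      D.cut_apply (measurableSet_cylinder a n) f, D.coeFn_add ((1 / 2 : ℂ) • g)
        (((1 / 2 : ℂ) * Complex.I * (-1) ^ (a n).val) •
          D.gen (Sum.inr n) (D.gen (Sum.inl n) g)),
      D.coeFn_smul (1 / 2 : ℂ) g, D.coeFn_smul ((1 / 2 : ℂ) * Complex.I * (-1) ^ (a n).val)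
        (D.gen (Sum.inr n) (D.gen (Sum.inl n) g)), D.gen_inr_gen_inl n g] with x h1 h2 h3 h4 h5 h6
    rw [← hg] at h2
    rw [h1, h3, h4, h5, h6, h2, smul_smul, ← add_smul]
    have hsign : (1 / 2 : ℂ) + 1 / 2 * Complex.I * (-1) ^ (a n).val *
        -((-1) ^ (x n).val * Complex.I) = if x n = a n then 1 else 0 := by
      have hI := Complex.I_mul_I
      have h := sign_mul_sign (a n) (x n)
      split_ifs at h ⊢ <;>
        linear_combination (1 / 2 : ℂ) * h - (1 / 2 : ℂ) * (-1) ^ (a n).val * (-1) ^ (x n).val * hI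
    have hiff : x ∈ cylinder a (n + 1) ↔ x ∈ cylinder a n ∧ x n = a n :=
      ⟨fun h => ⟨fun k hk => h k (hk.trans n.lt_succ_self), h n n.lt_succ_self⟩,
        fun h k hk => (Nat.lt_succ_iff_lt_or_eq.1 hk).elim (h.1 k) fun e => e ▸ h.2⟩
    rw [hsign]
    by_cases hx : x ∈ cylinder a n
    · by_cases hxn : x n = a n
      · rw [Set.indicator_of_mem (hiff.2 ⟨hx, hxn⟩), Set.indicator_of_mem hx, if_pos hxn, one_smul]
      · rw [Set.indicator_of_notMem (fun h => hxn (hiff.1 h).2), if_neg hxn, zero_smul]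
    · rw [Set.indicator_of_notMem hx, Set.indicator_of_notMem (fun h => hx (hiff.1 h).1), smul_zero]

/-- The cylinders around `a` decrease to `{a}`, so the cut-offs converge by dominated convergence.
-/
lemma cut_singleton_mem {U : Submodule ℂ D.H} (hc : IsClosed (U : Set D.H))
    (hU : IsInvariant (D.rep B) (U : Set D.H)) (a : X) {f : D.H} (hf : f ∈ U) :
    D.cut (measurableSet_singleton a) f ∈ U := by
  refine hc.mem_of_tendsto (D.tendsto_of_dominated (f := f)
    (F := fun n => D.cut (measurableSet_cylinder a n) f) (fun n => ?_) ?_)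
    (Eventually.of_forall (D.cut_cylinder_mem B hU a hf))
  · filter_upwards [D.cut_apply (measurableSet_cylinder a n) f] with x hx
    rw [hx]
    exact norm_indicator_le_norm_self _ _
  · filter_upwards [ae_all_iff.2 fun n => D.cut_apply (measurableSet_cylinder a n) f,
      D.cut_apply (measurableSet_singleton a) f] with x h1 h2
    rw [h2]
    refine tendsto_const_nhds.congr' ?_
    by_cases hx : x = a
    · subst hx
      refine Eventually.of_forall fun n => ?_
      have hn : x ∈ cylinder x n := fun _ _ => rfl
      beta_reduce
      rw [h1, Set.indicator_of_mem (Set.mem_singleton x), Set.indicator_of_mem hn]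
    · obtain ⟨k, hk⟩ := Function.ne_iff.1 hx
      filter_upwards [eventually_gt_atTop k] with n hn
      have hn' : x ∉ cylinder a n := fun h => hk (h k hn)
      rw [h1, Set.indicator_of_notMem (Set.mem_singleton_iff.not.2 hx),
        Set.indicator_of_notMem hn']

end Cylinders

/-! ### Values at single points. -/

/-- If `{a}` is a null set both sides are `0`, so the choice of representatives is harmless. -/
lemma inner_cut_singleton (a : X) (f g : D.H) :
    inner ℂ (D.cut (measurableSet_singleton a) f) g =
      D.μ.real {a} • inner ℂ ((f : Lp L2 2 D.μ) a) ((g : Lp L2 2 D.μ) a) := by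
  rw [← integral_singleton (f := fun x => inner ℂ ((f : Lp L2 2 D.μ) x) ((g : Lp L2 2 D.μ) x)),
    ← integral_indicator (measurableSet_singleton a)]
  refine (L2.inner_def (𝕜 := ℂ) (D.cut (measurableSet_singleton a) f : Lp L2 2 D.μ)
    (g : Lp L2 2 D.μ)).trans (integral_congr_ae ?_)
  filter_upwards [D.cut_apply (measurableSet_singleton a) f] with x hx
  rw [hx]
  by_cases h : x ∈ ({a} : Set X)
  · rw [Set.indicator_of_mem h, Set.indicator_of_mem h]
  · rw [Set.indicator_of_notMem h, Set.indicator_of_notMem h, inner_zero_left]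

/-- Where `f` does not vanish, the translate of `J f` does not vanish either. -/
lemma gen_apply_ne_zero (i : ℕ ⊕ ℕ) (f : D.H) : ∀ᵐ x ∂D.μ,
    (f : Lp L2 2 D.μ) x ≠ 0 → (D.gen i f : Lp L2 2 D.μ) (x + delta (pos i)) ≠ 0 := by
  -- Since `J² = -1`, the value of `f` at `x` is recovered from that of `J f` at `x + δ`.
  have h := D.gen_apply_eq_zero i (D.gen i f)
  rw [D.gen_self] at h
  have h' : ((-f : D.H) : Lp L2 2 D.μ) =ᵐ[D.μ] -(f : Lp L2 2 D.μ) :=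
    Lp.coeFn_neg (f : Lp L2 2 D.μ)
  filter_upwards [h, h'] with x h1 h2 hx h3
  have h4 := h1 h3
  rw [h2] at h4
  exact hx (neg_eq_zero.1 h4)

end Triple

lemma inner_eq_of_mem_fiber_one {v : L2} (hv : v ∈ fiber 1) (w : L2) :
    inner ℂ v w = inner ℂ (v 0) (w 0) := by
  rw [lp.inner_eq_tsum, tsum_eq_single 0]
  intro i hi
  rw [hv i (by exact_mod_cast Nat.one_le_iff_ne_zero.2 hi), inner_zero_left]

lemma apply_zero_ne_zero_of_mem_fiber_one {v : L2} (hv : v ∈ fiber 1) (h : v ≠ 0) : v 0 ≠ 0 := by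
  intro h0
  refine h (inner_self_eq_zero (𝕜 := ℂ).1 ?_)
  rw [inner_eq_of_mem_fiber_one hv, h0, inner_zero_left]

/-! ### The Fermi–Fock representation -/

section FermiFock

/-- Every point of `Δ` has positive mass, so elements of the Fock space have well-defined values
there. -/
lemma ae_fermiFock_iff {p : X → Prop} : (∀ᵐ x ∂fermiFock.μ, p x) ↔ ∀ x ∈ Delta, p x := by
  rw [ae_iff]
  refine (fockMeasure_eq_zero_iff _).trans (forall₂_congr fun x _ => ?_)
  simp

lemma isDiscrete_fermiFock : IsDiscrete fermiFock.μ :=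
  ⟨Delta, countable_Delta, (fockMeasure_eq_zero_iff _).2 fun _ h h' => h' h⟩

lemma fermiFock_singleton {x : X} (hx : x ∈ Delta) : fermiFock.μ {x} = 1 := by
  change fockMeasure {x} = 1
  rw [fockMeasure, measurableEmbedding_Delta.map_apply]
  have : (Subtype.val ⁻¹' {x} : Set Delta) = {⟨x, hx⟩} := by
    ext y
    simp [Subtype.ext_iff]
  rw [this, Measure.count_singleton]

lemma fermiFock_exists_ne_zero : ∃ f : fermiFock.H, f ≠ 0 := by
  -- The vacuum: the first basis vector of `ℓ²`, placed at the point `0` of `Δ`.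
  have hm : MemLp (Set.indicator {(0 : X)} fun _ => (lp.single 2 0 1 : L2)) 2 fermiFock.μ :=
    memLp_indicator_const 2 (measurableSet_singleton 0) _
      (Or.inr (by rw [fermiFock_singleton (zero_mem _)]; exact ENNReal.one_ne_top))
  have hae := hm.coeFn_toLp
  refine ⟨(Subtype.mk (hm.toLp _) ?_ : fermiFock.directIntegral), fun h => ?_⟩
  · filter_upwards [hae] with x hx
    rw [hx]
    by_cases h0 : x ∈ ({0} : Set X)
    · rw [Set.indicator_of_mem h0]
      intro i hi
      have hi' : i ≠ 0 := Nat.one_le_iff_ne_zero.1 (by exact_mod_cast (show (1 : ℕ∞) ≤ i from hi))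
      exact lp.single_apply_ne 2 0 _ hi'
    · rw [Set.indicator_of_notMem h0]
      exact zero_mem _
  · have h1 : hm.toLp _ = 0 := congrArg Subtype.val h
    rw [h1] at hae
    have h2 := ae_fermiFock_iff.1 (hae.symm.trans (Lp.coeFn_zero L2 2 _)) 0 (zero_mem _)
    rw [Set.indicator_of_mem (Set.mem_singleton _)] at h2
    have h3 := congrArg (fun v : L2 => v 0) h2
    simp at h3

variable {Z : Type*} [NormedAddCommGroup Z] [InnerProductSpace ℝ Z] [CompleteSpace Z]
  (B : UnitaryBasis Z)

lemma fermiFock_exists_mem_apply_ne_zero {U : Submodule ℂ fermiFock.H}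
    (hU : IsInvariant (fermiFock.rep B) (U : Set fermiFock.H)) (hne : U ≠ ⊥) {x : X}
    (hx : x ∈ Delta) : ∃ f ∈ U, (f : Lp L2 2 fermiFock.μ) x ≠ 0 := by
  obtain ⟨f, hf, hf0⟩ := U.exists_mem_ne_zero_of_ne_bot hne
  obtain ⟨a, ha, hfa⟩ : ∃ a ∈ Delta, (f : Lp L2 2 fermiFock.μ) a ≠ 0 := by
    by_contra! h
    refine hf0 (fermiFock.ext_ae ?_)
    filter_upwards [ae_fermiFock_iff.2 h, fermiFock.coeFn_zero] with x h1 h2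
    rw [h1, h2]
  -- The shift by `a + x` takes `a` to `x`, since `a + a = 0`. Membership in `Δ` is carried along
  -- because almost everywhere statements say something only at points of `Δ`.
  have h := Delta_induction (p := fun y => y ∈ Delta ∧ ∃ f ∈ U, (f : Lp L2 2 fermiFock.μ) y ≠ 0) a
    ⟨ha, f, hf, hfa⟩ (fun y k ⟨hy, g, hg, hgy⟩ => ⟨add_mem hy (delta_mem k),
      fermiFock.gen (Sum.inl k) g, fermiFock.gen_mem_of_isInvariant B hU _ hg,
      ae_fermiFock_iff.1 (fermiFock.gen_apply_ne_zero (Sum.inl k) g) y hy hgy⟩) (a + x)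
    (add_mem ha hx)
  rw [← add_assoc, add_self, zero_add] at h
  exact h.2

/-- If `g` is orthogonal to `U`, it is orthogonal to the restriction to `{x}` of some `f ∈ U` with
`f(x) ≠ 0`; in a one-dimensional fibre this forces `g(x) = 0`. -/
theorem fermiFock_isIrreducibleOverC : IsIrreducibleOverC (fermiFock.rep B) := by
  obtain ⟨f, hf⟩ := fermiFock_exists_ne_zero
  refine ⟨⟨f, 0, hf⟩, fun U hc hU => or_iff_not_imp_left.2 fun hne => ?_⟩
  have : CompleteSpace U := hc.completeSpace_coe
  rw [← Submodule.orthogonal_eq_bot_iff, Submodule.eq_bot_iff]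
  intro g hg
  refine fermiFock.ext_ae ?_
  have hg0 : ∀ x ∈ Delta, (g : Lp L2 2 fermiFock.μ) x = 0 := by
    intro x hx
    obtain ⟨f, hf, hfx⟩ := fermiFock_exists_mem_apply_ne_zero B hU hne hx
    have hmem : ∀ f : fermiFock.H, (f : Lp L2 2 fermiFock.μ) x ∈ fiber 1 := fun f =>
      ae_fermiFock_iff.1 (show ∀ᵐ x ∂fermiFock.μ, (f : Lp L2 2 fermiFock.μ) x ∈ fiber 1 from f.2)
        x hx
    have h := hg _ (fermiFock.cut_singleton_mem B hc hU x hf)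
    rw [fermiFock.inner_cut_singleton, measureReal_def, fermiFock_singleton hx, ENNReal.toReal_one,
      one_smul, inner_eq_of_mem_fiber_one (hmem f)] at h
    by_contra hgx
    have h1 := apply_zero_ne_zero_of_mem_fiber_one (hmem f) hfx
    have h2 := apply_zero_ne_zero_of_mem_fiber_one (hmem g) hgx
    rw [RCLike.inner_apply, mul_eq_zero, map_eq_zero] at h
    exact h.elim h2 h1
  filter_upwards [ae_fermiFock_iff.2 hg0, fermiFock.coeFn_zero] with x h1 h2
  rw [h1, h2]

end FermiFock

/-! ### Real forms. -/

lemma not_isInvariantRealForm_of_isIrreducibleOverR {Z : Type*} [NormedAddCommGroup Z]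
    [InnerProductSpace ℝ Z] {H : Type*} [NormedAddCommGroup H] [InnerProductSpace ℂ H]
    {ρ : Cl Z →ₐ[ℝ] (H →L[ℂ] H)} (h : IsIrreducibleOverR ρ) (V : Submodule ℝ H) :
    ¬ IsInvariantRealForm ρ V := by
  intro hV
  obtain ⟨f, hf⟩ := @exists_ne _ h.1 (0 : H)
  rcases h.2 V hV.isClosed hV.invariant with rfl | rfl
  · obtain ⟨p, ⟨h1, h2, h3⟩, -⟩ := hV.decomposition f
    rw [Submodule.mem_bot] at h1 h2
    rw [h1, h2, smul_zero, add_zero] at h3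
    exact hf h3
  · have h1 := hV.inner_real f trivial (Complex.I • f) trivial
    rw [inner_smul_right, Complex.I_mul_im] at h1
    exact hf (inner_self_eq_zero (𝕜 := ℂ).1
      (Complex.ext h1 (inner_self_im (𝕜 := ℂ) f)))

end GW

end

theorem corollary3p7 {Z : Type*} [NormedAddCommGroup Z] [InnerProductSpace ℝ Z]
    [CompleteSpace Z] (B : GW.UnitaryBasis Z) :
    (∀ D : GW.Triple, GW.IsDiscrete D.μ → GW.IsIrreducibleOverC (D.rep B) →
      GW.IsIrreducibleOverR (D.rep B)) ∧
    GW.IsIrreducibleOverC (GW.fermiFock.rep B) ∧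
    GW.IsIrreducibleOverR (GW.fermiFock.rep B) ∧
    ¬ ∃ V : Submodule ℝ GW.fermiFock.H, GW.IsInvariantRealForm (GW.fermiFock.rep B) V :=
  have hC := GW.fermiFock_isIrreducibleOverC B
  have hR := GW.fermiFock.isIrreducibleOverR_of_isDiscrete B GW.isDiscrete_fermiFock hC
  ⟨fun D hd h => D.isIrreducibleOverR_of_isDiscrete B hd h, hC, hR,
    fun ⟨V, hV⟩ => GW.not_isInvariantRealForm_of_isIrreducibleOverR hR V hV⟩
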